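/- Let $p\ge 2$, let $f=(f_1,\dots,f_p):\mathbb{R}^n\to\mathbb{R}^p$ and $g=(g_1,\dots,g_q):\mathbb{R}^n\to\mathbb{R}^q$ have locally Lipschitz components, and consider the problem of minimizing $f(x)$ (with respect to the ordering cone $\mathbb{R}^p_+$) over $$\Omega_1=\{x\in\mathbb{R}^n:\ g_j(x)\le 0,\ j=1,\dots,q\}.$$ Suppose that $\Omega_1$ is convex, let $\bar x\in\Omega_1$, and put $A(\bar x)=\{j:\ g_j(\bar x)=0\}$. A point $\bar x\in\Omega_1$ is an efficient solution for an objective $F:\mathbb{R}^n\to\mathbb{R}^p$ if there is no $x\in\Omega_1$ with $F(x)-F(\bar x)\in-\mathbb{R}^p_+\setminus\{0\}$. It is a norm-based robust efficient solution for $f$ if there is $r>0$ such that, for every real $p\times n$ matrix $C$ with Frobenius norm $\|C\|<r$, $\bar x$ is an efficient solution for the objective $x\mapsto f(x)+Cx$. For a locally Lipschitz $h:\mathbb{R}^n\to\mathbb{R}$, the Clarke generalized gradient is $$\partial_c h(\bar x)=\{\zeta\in\mathbb{R}^n:\ \zeta^T d\le h^\circ(\bar x;d)\ \ \forall d\in\mathbb{R}^n\},\qquad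 h^\circ(\bar x;d)=\limsup_{x\to\bar x,\ t\downarrow 0}\frac{h(x+td)-h(x)}{t}.$$ For $S\subseteq\mathbb{R}^n$, $co(S)$ is the convex hull and $pos(S)$ is the set of all finite sums $\sum_k\lambda_k y_k$ with $\lambda_k\ge0$ and $y_k\in S$ (the empty sum being allowed, so $pos(\emptyset)=\{0\}$). (i) If $\bar x$ is a norm-based robust efficient solution and $0\notin co\big(\bigcup_{j\in A(\bar x)}\partial_c g_j(\bar x)\big)$, then $$pos\Big(\bigcup_{i=1}^p\partial_c f_i(\bar x)\Big)+pos\Big(\bigcup_{j\in A(\bar x)}\partial_c g_j(\bar x)\Big)=\mathbb{R}^n.\qquad(*)$$ (ii) If $f_1,\dots,f_p$ and $g_1,\dots,g_q$ are convex and $(*)$ holds, then $\bar x$ is a norm-based robust efficient solution. -/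

import Mathlib

noncomputable section

namespace NormRobust

open Filter Topology
open scoped Pointwise Matrix.Norms.Frobenius

/-- Clarke's generalized directional derivative `h°(x; d)`, the upper limit of
`(h (y + t d) - h y) / t` as `y → x` and `t ↓ 0`, for `h` locally Lipschitz at `x`. -/
def clarkeDeriv {n : ℕ} (h : EuclideanSpace ℝ (Fin n) → ℝ) (x d : EuclideanSpace ℝ (Fin n)) : ℝ :=
  limsup (fun z : EuclideanSpace ℝ (Fin n) × ℝ => (h (z.1 + z.2 • d) - h z.1) / z.2)
    (𝓝 x ×ˢ 𝓝[>] (0 : ℝ))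

/-- Clarke's generalized gradient of `h` at `x`. -/
def clarkeGradient {n : ℕ} (h : EuclideanSpace ℝ (Fin n) → ℝ) (x : EuclideanSpace ℝ (Fin n)) :
    Set (EuclideanSpace ℝ (Fin n)) :=
  {ζ | ∀ d : EuclideanSpace ℝ (Fin n), inner ℝ ζ d ≤ clarkeDeriv h x d}

/-- The convex cone generated by `S`: all finite sums `∑ λ_i y_i` with `λ_i ≥ 0` and `y_i ∈ S`;
the empty sum is allowed, so that `0` always belongs to it. -/
def pos {n : ℕ} (S : Set (EuclideanSpace ℝ (Fin n))) : Set (EuclideanSpace ℝ (Fin n)) :=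
  (PointedCone.hull ℝ S : Set (EuclideanSpace ℝ (Fin n)))

/-- The natural ordering cone of `ℝᵖ`. -/
def nonnegOrthant (p : ℕ) : Set (EuclideanSpace ℝ (Fin p)) := {y | ∀ i, 0 ≤ y i}

/-- `xbar` is an efficient solution of `min f(x)` subject to `x ∈ Ω`, with respect to `K`. -/
def IsEfficient {n p : ℕ} (K : Set (EuclideanSpace ℝ (Fin p)))
    (f : EuclideanSpace ℝ (Fin n) → EuclideanSpace ℝ (Fin p))
    (Ω : Set (EuclideanSpace ℝ (Fin n))) (xbar : EuclideanSpace ℝ (Fin n)) : Prop :=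
  xbar ∈ Ω ∧ ¬ ∃ x ∈ Ω, f x - f xbar ∈ (-K) \ {0}

/-- `xbar` is a norm-based robust efficient solution of `min f(x)` subject to `x ∈ Ω`, with respect
to `K`: it stays efficient for `f(x) + C x` for all matrices `C` of Frobenius norm less than some
`r > 0`. -/
def IsNormRobustEfficient {n p : ℕ} (K : Set (EuclideanSpace ℝ (Fin p)))
    (f : EuclideanSpace ℝ (Fin n) → EuclideanSpace ℝ (Fin p))
    (Ω : Set (EuclideanSpace ℝ (Fin n))) (xbar : EuclideanSpace ℝ (Fin n)) : Prop :=
  ∃ r : ℝ, 0 < r ∧ ∀ C : Matrix (Fin p) (Fin n) ℝ, ‖C‖ < r →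
    IsEfficient K (fun x => f x + Matrix.toEuclideanLin C x) Ω xbar

/-- The feasible set given by the constraints `g_j(x) ≤ 0`. -/
def feasibleSet {n q : ℕ} (g : EuclideanSpace ℝ (Fin n) → EuclideanSpace ℝ (Fin q)) :
    Set (EuclideanSpace ℝ (Fin n)) :=
  {x | ∀ j, g x j ≤ 0}

/-- The indices of the constraints that are active at `x`. -/
def activeSet {n q : ℕ} (g : EuclideanSpace ℝ (Fin n) → EuclideanSpace ℝ (Fin q))
    (x : EuclideanSpace ℝ (Fin n)) : Set (Fin q) :=
  {j | g x j = 0}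

end NormRobust

end

open scoped Pointwise

namespace NormRobust

open Filter Topology Set
open scoped Pointwise Matrix.Norms.Frobenius NNReal

/-! ### Sublinearity of the Clarke directional derivative -/

section ClarkeDerivative

variable {n : ℕ} {h : EuclideanSpace ℝ (Fin n) → ℝ} {x : EuclideanSpace ℝ (Fin n)}

/-! Let `K` be the sum of the two cones. (i) If `K` is proper, its polar contains some `d ≠ 0`. As
the Clarke derivative is the support function of the gradient, it is `≤ 0` along `d` for every
objective and every active constraint. Separating `0` from the compact hull of the active gradients
gives `d₀` along which active constraints strictly decrease, so `d + ε • d₀` is feasible for small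
steps. A small matrix with all rows `-s d` lowers every objective along it at a rate near `s ‖d‖²`,
which beats the error `ε f_i°(d₀)`; efficiency fails.

(ii) If `K` is everything, each `±e_k` lies in it, so upper bounds on the generators control the
whole norm of a direction (`exists_norm_le_of_pos_add_pos_eq_univ`). For a dominating `x` and `d = x
- xbar`, convexity bounds the objective generators by `‖C‖ ‖d‖` and the constraint ones by `0`.
Hence `‖d‖ ≤ M ‖C‖ ‖d‖`, so `d = 0` for small `C`. -/

theorem tendsto_fst_add_smul (x d : EuclideanSpace ℝ (Fin n)) :
    Tendsto (fun z : EuclideanSpace ℝ (Fin n) × ℝ => z.1 + z.2 • d)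
      (𝓝 x ×ˢ 𝓝[>] (0 : ℝ)) (𝓝 x) := by
  have hc : Tendsto (fun z : EuclideanSpace ℝ (Fin n) × ℝ => z.1 + z.2 • d)
      (𝓝 (x, (0 : ℝ))) (𝓝 (x + (0 : ℝ) • d)) :=
    Continuous.tendsto (f := fun z : EuclideanSpace ℝ (Fin n) × ℝ => z.1 + z.2 • d)
      (by fun_prop) (x, 0)
  rw [zero_smul, add_zero, nhds_prod_eq] at hc
  exact hc.mono_left (prod_mono le_rfl nhdsWithin_le_nhds)

theorem eventually_snd_pos (x : EuclideanSpace ℝ (Fin n)) :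
    ∀ᶠ z : EuclideanSpace ℝ (Fin n) × ℝ in 𝓝 x ×ˢ 𝓝[>] (0 : ℝ), 0 < z.2 :=
  tendsto_snd.eventually self_mem_nhdsWithin

theorem exists_eventually_abs_quotient_le (hh : LocallyLipschitz h)
    (x : EuclideanSpace ℝ (Fin n)) :
    ∃ L : ℝ≥0, ∀ d, ∀ᶠ z : EuclideanSpace ℝ (Fin n) × ℝ in 𝓝 x ×ˢ 𝓝[>] (0 : ℝ),
      |(h (z.1 + z.2 • d) - h z.1) / z.2| ≤ L * ‖d‖ := by
  obtain ⟨L, t, ht, hL⟩ := hh x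
  refine ⟨L, fun d => ?_⟩
  filter_upwards [tendsto_fst.eventually ht, (tendsto_fst_add_smul x d).eventually ht,
    eventually_snd_pos x] with z h1 h2 h3
  have := hL.dist_le_mul _ h2 _ h1
  rw [Real.dist_eq, dist_eq_norm, add_sub_cancel_left, norm_smul, Real.norm_of_nonneg h3.le]
    at this
  rw [abs_div, abs_of_pos h3, div_le_iff₀ h3]
  linarith

theorem eventually_quotient_lt (hh : LocallyLipschitz h) {d : EuclideanSpace ℝ (Fin n)} {c : ℝ}
    (hc : clarkeDeriv h x d < c) :
    ∀ᶠ z : EuclideanSpace ℝ (Fin n) × ℝ in 𝓝 x ×ˢ 𝓝[>] (0 : ℝ),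
      (h (z.1 + z.2 • d) - h z.1) / z.2 < c := by
  obtain ⟨L, hL⟩ := exists_eventually_abs_quotient_le hh x
  exact eventually_lt_of_limsup_lt hc
    (isBoundedUnder_of_eventually_le ((hL d).mono fun z hz => (abs_le.1 hz).2))

theorem clarkeDeriv_le (hh : LocallyLipschitz h) {d : EuclideanSpace ℝ (Fin n)} {c : ℝ}
    (hc : ∀ᶠ z : EuclideanSpace ℝ (Fin n) × ℝ in 𝓝 x ×ˢ 𝓝[>] (0 : ℝ),
      (h (z.1 + z.2 • d) - h z.1) / z.2 ≤ c) :
    clarkeDeriv h x d ≤ c := by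
  obtain ⟨L, hL⟩ := exists_eventually_abs_quotient_le hh x
  exact limsup_le_of_le (IsBoundedUnder.isCoboundedUnder_le
    (isBoundedUnder_of_eventually_ge ((hL d).mono fun z hz => (abs_le.1 hz).1))) hc

theorem exists_clarkeDeriv_le_mul_norm (hh : LocallyLipschitz h)
    (x : EuclideanSpace ℝ (Fin n)) : ∃ L : ℝ≥0, ∀ d, clarkeDeriv h x d ≤ L * ‖d‖ := by
  obtain ⟨L, hL⟩ := exists_eventually_abs_quotient_le hh x
  exact ⟨L, fun d => clarkeDeriv_le hh ((hL d).mono fun z hz => (abs_le.1 hz).2)⟩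

theorem clarkeDeriv_zero (h : EuclideanSpace ℝ (Fin n) → ℝ) (x : EuclideanSpace ℝ (Fin n)) :
    clarkeDeriv h x 0 = 0 := by
  simp [clarkeDeriv]

theorem clarkeDeriv_smul_le (hh : LocallyLipschitz h) {c : ℝ} (hc : 0 < c)
    (d : EuclideanSpace ℝ (Fin n)) :
    clarkeDeriv h x (c • d) ≤ c * clarkeDeriv h x d := by
  refine le_of_forall_pos_le_add fun ε hε => ?_
  have hlt : clarkeDeriv h x d < clarkeDeriv h x d + ε / c :=
    lt_add_of_pos_right _ (div_pos hε hc)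
  have hmul : Tendsto (fun t : ℝ => c * t) (𝓝[>] 0) (𝓝[>] 0) := by
    refine tendsto_nhdsWithin_of_tendsto_nhds_of_eventually_within _ ?_ ?_
    · have : Tendsto (fun t : ℝ => c * t) (𝓝 0) (𝓝 (c * 0)) :=
        Continuous.tendsto (by fun_prop) 0
      rw [mul_zero] at this
      exact this.mono_left nhdsWithin_le_nhds
    · filter_upwards [self_mem_nhdsWithin] with t ht
      exact mul_pos hc ht
  have hmap : Tendsto (fun z : EuclideanSpace ℝ (Fin n) × ℝ => (z.1, c * z.2))
      (𝓝 x ×ˢ 𝓝[>] (0 : ℝ)) (𝓝 x ×ˢ 𝓝[>] (0 : ℝ)) :=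
    tendsto_fst.prodMk (hmul.comp tendsto_snd)
  refine clarkeDeriv_le hh ?_
  filter_upwards [hmap.eventually (eventually_quotient_lt hh hlt), eventually_snd_pos x]
    with z hz hz0
  have hz' := mul_lt_mul_of_pos_left hz hc
  have e1 : c * (clarkeDeriv h x d + ε / c) = c * clarkeDeriv h x d + ε := by field_simp
  have e2 : c * ((h (z.1 + (c * z.2) • d) - h z.1) / (c * z.2))
      = (h (z.1 + z.2 • c • d) - h z.1) / z.2 := by
    rw [smul_smul, mul_comm z.2 c]
    field_simp
  rw [e1, e2] at hz'
  exact hz'.le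

theorem clarkeDeriv_smul (hh : LocallyLipschitz h) {c : ℝ} (hc : 0 < c)
    (d : EuclideanSpace ℝ (Fin n)) :
    clarkeDeriv h x (c • d) = c * clarkeDeriv h x d := by
  refine (clarkeDeriv_smul_le hh hc d).antisymm ?_
  have := clarkeDeriv_smul_le (x := x) hh (inv_pos.2 hc) (c • d)
  rw [inv_smul_smul₀ hc.ne'] at this
  calc c * clarkeDeriv h x d ≤ c * (c⁻¹ * clarkeDeriv h x (c • d)) :=
        mul_le_mul_of_nonneg_left this hc.le
    _ = clarkeDeriv h x (c • d) := mul_inv_cancel_left₀ hc.ne' _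

/-- The quotient splits at the shifted base point `y + t e`, which still tends to `x`; the moving
base point in the upper limit is what makes this work. -/
theorem clarkeDeriv_add_le (hh : LocallyLipschitz h) (d e : EuclideanSpace ℝ (Fin n)) :
    clarkeDeriv h x (d + e) ≤ clarkeDeriv h x d + clarkeDeriv h x e := by
  refine le_of_forall_pos_le_add fun ε hε => ?_
  have hmap : Tendsto (fun z : EuclideanSpace ℝ (Fin n) × ℝ => (z.1 + z.2 • e, z.2))
      (𝓝 x ×ˢ 𝓝[>] (0 : ℝ)) (𝓝 x ×ˢ 𝓝[>] (0 : ℝ)) :=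
    (tendsto_fst_add_smul x e).prodMk tendsto_snd
  refine clarkeDeriv_le hh ?_
  filter_upwards [hmap.eventually (eventually_quotient_lt hh
      (lt_add_of_pos_right (clarkeDeriv h x d) (half_pos hε))),
    eventually_quotient_lt hh (lt_add_of_pos_right (clarkeDeriv h x e) (half_pos hε))]
    with z h1 h2
  have e1 : z.1 + z.2 • (d + e) = z.1 + z.2 • e + z.2 • d := by
    rw [smul_add]; abel
  have e2 : (h (z.1 + z.2 • (d + e)) - h z.1) / z.2
      = (h (z.1 + z.2 • e + z.2 • d) - h (z.1 + z.2 • e)) / z.2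
        + (h (z.1 + z.2 • e) - h z.1) / z.2 := by
    rw [e1, ← add_div]; ring
  rw [e2]
  linarith

theorem eventually_lt_add_mul (hh : LocallyLipschitz h) {d : EuclideanSpace ℝ (Fin n)} {c : ℝ}
    (hc : clarkeDeriv h x d < c) :
    ∀ᶠ t in 𝓝[>] (0 : ℝ), h (x + t • d) < h x + t * c := by
  have hmap : Tendsto (fun t : ℝ => (x, t)) (𝓝[>] 0) (𝓝 x ×ˢ 𝓝[>] (0 : ℝ)) :=
    tendsto_const_nhds.prodMk tendsto_id
  filter_upwards [hmap.eventually (eventually_quotient_lt hh hc), self_mem_nhdsWithin]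
    with t ht ht0
  have := (div_lt_iff₀ (show (0 : ℝ) < t from ht0)).1 ht
  linarith

end ClarkeDerivative

/-! ### The generalized gradient -/

section ClarkeGradient

variable {n : ℕ} {h : EuclideanSpace ℝ (Fin n) → ℝ} {x : EuclideanSpace ℝ (Fin n)}

/-- The generalized directional derivative is the support function of the generalized gradient. -/
theorem exists_mem_clarkeGradient_inner_eq (hh : LocallyLipschitz h)
    (x d : EuclideanSpace ℝ (Fin n)) :
    ∃ ζ ∈ clarkeGradient h x, inner ℝ ζ d = clarkeDeriv h x d := by
  have hsingle : ∀ c : ℝ, c • d = 0 → RingHom.id ℝ c • clarkeDeriv h x d = 0 := by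
    intro c hc
    rcases smul_eq_zero.1 hc with h0 | h0
    · rw [h0, map_zero, zero_smul]
    · rw [h0, clarkeDeriv_zero, smul_zero]
  -- Hahn–Banach: extend `c • d ↦ c * h°(x; d)` from the line through `d`, dominated by the
  -- sublinear `h°`.
  obtain ⟨φ, hφ, hφle⟩ := exists_extension_of_le_sublinear
    (LinearPMap.mkSpanSingleton' d (clarkeDeriv h x d) hsingle) (clarkeDeriv h x)
    (fun c hc e => clarkeDeriv_smul hh hc e) (clarkeDeriv_add_le hh) (by
      rintro ⟨y, hy⟩
      obtain ⟨c, rfl⟩ := Submodule.mem_span_singleton.1 hy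
      rw [LinearPMap.mkSpanSingleton'_apply, smul_eq_mul]
      change c * clarkeDeriv h x d ≤ clarkeDeriv h x (c • d)
      rcases lt_trichotomy c 0 with hc | rfl | hc
      · have h1 := clarkeDeriv_add_le (x := x) hh (c • d) ((-c) • d)
        rw [← add_smul, add_neg_cancel, zero_smul, clarkeDeriv_zero,
          clarkeDeriv_smul hh (neg_pos.2 hc)] at h1
        linarith
      · rw [zero_mul, zero_smul, clarkeDeriv_zero]
      · rw [clarkeDeriv_smul hh hc])
  have hin : ∀ e, inner ℝ ((InnerProductSpace.toDual ℝ (EuclideanSpace ℝ (Fin n))).symm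
      (LinearMap.toContinuousLinearMap φ)) e = φ e := fun e => by
    rw [InnerProductSpace.toDual_symm_apply]; rfl
  refine ⟨_, fun e => (hin e).trans_le (hφle e), (hin d).trans ?_⟩
  have hmem : d ∈ (LinearPMap.mkSpanSingleton' d (clarkeDeriv h x d) hsingle).domain :=
    Submodule.mem_span_singleton_self d
  rw [hφ ⟨d, hmem⟩, LinearPMap.mkSpanSingleton'_apply_self]

theorem convex_clarkeGradient (h : EuclideanSpace ℝ (Fin n) → ℝ)
    (x : EuclideanSpace ℝ (Fin n)) : Convex ℝ (clarkeGradient h x) := by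
  intro ζ hζ η hη a b ha hb hab d
  rw [inner_add_left, real_inner_smul_left, real_inner_smul_left]
  calc a * inner ℝ ζ d + b * inner ℝ η d
      ≤ a * clarkeDeriv h x d + b * clarkeDeriv h x d :=
        add_le_add (mul_le_mul_of_nonneg_left (hζ d) ha) (mul_le_mul_of_nonneg_left (hη d) hb)
    _ = clarkeDeriv h x d := by rw [← add_mul, hab, one_mul]

theorem isCompact_clarkeGradient (hh : LocallyLipschitz h) (x : EuclideanSpace ℝ (Fin n)) :
    IsCompact (clarkeGradient h x) := by
  obtain ⟨L, hL⟩ := exists_clarkeDeriv_le_mul_norm hh x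
  refine Metric.isCompact_of_isClosed_isBounded ?_ ?_
  · simp only [clarkeGradient, ofPred_forall]
    exact isClosed_iInter fun d => isClosed_le (by fun_prop) continuous_const
  · refine isBounded_iff_forall_norm_le.2 ⟨L, fun ζ hζ => ?_⟩
    -- Testing `ζ` against itself gives `‖ζ‖² ≤ L ‖ζ‖`.
    have h1 := (hζ ζ).trans (hL ζ)
    rw [real_inner_self_eq_norm_mul_norm] at h1
    rcases (norm_nonneg ζ).eq_or_lt with h0 | h0
    · rw [← h0]; exact L.2
    · exact le_of_mul_le_mul_right h1 h0

/-- A Clarke subgradient of a convex function is a subgradient. -/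
theorem inner_le_sub_of_convexOn (hh : LocallyLipschitz h) (hconv : ConvexOn ℝ univ h)
    {ζ : EuclideanSpace ℝ (Fin n)} (hζ : ζ ∈ clarkeGradient h x)
    (d : EuclideanSpace ℝ (Fin n)) : inner ℝ ζ d ≤ h (x + d) - h x := by
  refine (hζ d).trans (le_of_forall_pos_le_add fun ε hε => clarkeDeriv_le hh ?_)
  have hcont : Tendsto (fun y => h (y + d) - h y) (𝓝 x) (𝓝 (h (x + d) - h x)) :=
    Continuous.tendsto ((hh.continuous.comp (by fun_prop)).sub hh.continuous) x
  have hev : ∀ᶠ y in 𝓝 x, h (y + d) - h y < h (x + d) - h x + ε :=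
    hcont.eventually_lt_const (lt_add_of_pos_right _ hε)
  have hle : ∀ᶠ t in 𝓝[>] (0 : ℝ), t < 1 :=
    nhdsWithin_le_nhds (Iio_mem_nhds one_pos)
  filter_upwards [tendsto_fst.eventually hev, tendsto_snd.eventually hle,
    eventually_snd_pos x] with z h1 h2 h3
  refine le_trans ?_ h1.le
  rw [div_le_iff₀ h3]
  -- For `t < 1` convexity bounds the difference quotient by its value at `t = 1`.
  have h4 := hconv.2 (mem_univ z.1) (mem_univ (z.1 + d)) (sub_nonneg.2 h2.le) h3.le (by ring)
  have h5 : (1 - z.2) • z.1 + z.2 • (z.1 + d) = z.1 + z.2 • d := by module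
  rw [h5, smul_eq_mul, smul_eq_mul] at h4
  linarith

end ClarkeGradient

/-! ### Separation and cones -/

section ConvexGeometry

theorem isCompact_convexJoin {E : Type*} [AddCommGroup E] [Module ℝ E] [TopologicalSpace E]
    [ContinuousAdd E] [ContinuousSMul ℝ E] {s t : Set E} (hs : IsCompact s) (ht : IsCompact t) :
    IsCompact (convexJoin ℝ s t) := by
  have himage : convexJoin ℝ s t =
      (fun z : ℝ × E × E => (1 - z.1) • z.2.1 + z.1 • z.2.2) '' (Icc 0 1 ×ˢ s ×ˢ t) := by
    ext y
    simp only [mem_convexJoin, segment_eq_image, mem_image, mem_prod, Prod.exists]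
    constructor
    · rintro ⟨a, ha, b, hb, θ, hθ, rfl⟩
      exact ⟨θ, a, b, ⟨hθ, ha, hb⟩, rfl⟩
    · rintro ⟨θ, a, b, ⟨hθ, ha, hb⟩, rfl⟩
      exact ⟨a, ha, b, hb, θ, hθ, rfl⟩
  rw [himage]
  exact (isCompact_Icc.prod (hs.prod ht)).image (by fun_prop)

/-- By induction: the hull of a union of two nonempty convex sets is their join, a continuous image
of a compact product. -/
theorem isCompact_convexHull_biUnion {E ι : Type*} [AddCommGroup E] [Module ℝ E]
    [TopologicalSpace E] [ContinuousAdd E] [ContinuousSMul ℝ E] {A : Set ι} (hA : A.Finite)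
    {C : ι → Set E} (hcomp : ∀ j ∈ A, IsCompact (C j)) (hconv : ∀ j ∈ A, Convex ℝ (C j)) :
    IsCompact (convexHull ℝ (⋃ j ∈ A, C j)) := by
  induction A, hA using Set.Finite.induction_on with
  | empty => simp
  | @insert a s _ _ ih =>
    rw [biUnion_insert]
    have ih' := ih (fun j hj => hcomp j (mem_insert_of_mem a hj))
      (fun j hj => hconv j (mem_insert_of_mem a hj))
    have ha := hcomp a (mem_insert a s)
    have ha' := hconv a (mem_insert a s)
    rcases (C a).eq_empty_or_nonempty with h0 | h0
    · rwa [h0, empty_union]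
    rcases (⋃ j ∈ s, C j).eq_empty_or_nonempty with h1 | h1
    · rwa [h1, union_empty, ha'.convexHull_eq]
    · rw [convexHull_union h0 h1, ha'.convexHull_eq]
      exact isCompact_convexJoin ha ih'

/-- A proper convex cone in a finite-dimensional space has a nonzero polar vector. -/
theorem exists_ne_zero_forall_inner_nonpos {E : Type*} [NormedAddCommGroup E]
    [InnerProductSpace ℝ E] [FiniteDimensional ℝ E] (K : PointedCone ℝ E)
    (hK : (K : Set E) ≠ univ) : ∃ d ≠ (0 : E), ∀ y ∈ K, inner ℝ y d ≤ 0 := by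
  -- A dense convex set in finite dimension is the whole space: it spans, so it has interior points,
  -- and then it has the same interior as its closure. Thus `K` need not be closed.
  have hclosure : closure (K : Set E) ≠ univ := by
    intro hcl
    refine hK ?_
    have hspan : affineSpan ℝ (K : Set E) = ⊤ := by
      have hle : closure (K : Set E) ⊆ affineSpan ℝ (K : Set E) :=
        closure_minimal (subset_affineSpan ℝ _) (AffineSubspace.closed_of_finiteDimensional _)
      rw [hcl] at hle
      exact SetLike.coe_injective (univ_subset_iff.1 hle)
    have hint := K.convex.interior_closure_eq_interior_of_nonempty_interior
      (K.convex.interior_nonempty_iff_affineSpan_eq_top.2 hspan)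
    rw [hcl, interior_univ] at hint
    exact univ_subset_iff.1 (hint.subset.trans interior_subset)
  obtain ⟨y₀, hy₀⟩ := (ne_univ_iff_exists_notMem _).1 hclosure
  let P : ProperCone ℝ E := ⟨K.closure, by
    exact isClosed_closure⟩
  obtain ⟨d, hd, hd0⟩ := ProperCone.hyperplane_separation' P (x₀ := y₀) hy₀
  refine ⟨-d, ?_, fun y hy => ?_⟩
  · rintro h0
    rw [neg_eq_zero.1 h0, inner_zero_right] at hd0
    exact lt_irrefl _ hd0
  · rw [inner_neg_right]
    exact neg_nonpos.2 (hd y (subset_closure hy))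

theorem exists_forall_inner_neg {E : Type*} [NormedAddCommGroup E] [InnerProductSpace ℝ E]
    [CompleteSpace E] {S : Set E} (hS : IsCompact (convexHull ℝ S))
    (h0 : (0 : E) ∉ convexHull ℝ S) : ∃ d : E, ∀ y ∈ S, inner ℝ y d < 0 := by
  obtain ⟨φ, u, hu, hφ⟩ := geometric_hahn_banach_closed_point (convex_convexHull ℝ S)
    hS.isClosed h0
  refine ⟨(InnerProductSpace.toDual ℝ E).symm φ, fun y hy => ?_⟩
  rw [real_inner_comm, InnerProductSpace.toDual_symm_apply]
  rw [map_zero] at hφ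
  exact (hu y (subset_convexHull ℝ S hy)).trans hφ

/-- `M` is the sum of the coefficients in a representation of `y`, hence independent of `d` and `r`.
-/
theorem exists_bound_of_mem_hull {E : Type*} [NormedAddCommGroup E] [InnerProductSpace ℝ E]
    {S : Set E} {y : E} (hy : y ∈ PointedCone.hull ℝ S) :
    ∃ M : ℝ, 0 ≤ M ∧ ∀ (d : E) (r : ℝ), (∀ ζ ∈ S, inner ℝ ζ d ≤ r) → inner ℝ y d ≤ M * r := by
  induction hy using Submodule.span_induction with
  | mem y hy => exact ⟨1, zero_le_one, fun d r h => by simpa using h y hy⟩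
  | zero => exact ⟨0, le_rfl, fun d r _ => by simp⟩
  | add y z _ _ ihy ihz =>
    obtain ⟨M, hM, h1⟩ := ihy
    obtain ⟨N, hN, h2⟩ := ihz
    refine ⟨M + N, add_nonneg hM hN, fun d r h => ?_⟩
    rw [inner_add_left, add_mul]
    exact add_le_add (h1 d r h) (h2 d r h)
  | smul a y _ ih =>
    obtain ⟨M, hM, h1⟩ := ih
    refine ⟨a * M, mul_nonneg a.2 hM, fun d r h => ?_⟩
    have : inner ℝ (a • y) d = (a : ℝ) * inner ℝ y d := real_inner_smul_left y d (a : ℝ)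
    rw [this, mul_assoc]
    exact mul_le_mul_of_nonneg_left (h1 d r h) a.2

/-- If two cones add up to the whole space, then a direction on which the generators of the second
are nonpositive is controlled in norm by the values of the generators of the first. -/
theorem exists_norm_le_of_pos_add_pos_eq_univ {n : ℕ} {S T : Set (EuclideanSpace ℝ (Fin n))}
    (hST : pos S + pos T = univ) :
    ∃ M : ℝ, 0 ≤ M ∧ ∀ (d : EuclideanSpace ℝ (Fin n)) (r : ℝ), 0 ≤ r →
      (∀ ζ ∈ S, inner ℝ ζ d ≤ r) → (∀ η ∈ T, inner ℝ η d ≤ 0) → ‖d‖ ≤ M * r := by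
  have key : ∀ y : EuclideanSpace ℝ (Fin n), ∃ M : ℝ, 0 ≤ M ∧
      ∀ (d : EuclideanSpace ℝ (Fin n)) (r : ℝ),
      (∀ ζ ∈ S, inner ℝ ζ d ≤ r) → (∀ η ∈ T, inner ℝ η d ≤ 0) → inner ℝ y d ≤ M * r := by
    intro y
    obtain ⟨a, ha, b, hb, rfl⟩ := mem_add.1 (hST.symm.subset (mem_univ y))
    obtain ⟨M, hM, h1⟩ := exists_bound_of_mem_hull ha
    obtain ⟨N, -, h2⟩ := exists_bound_of_mem_hull hb
    refine ⟨M, hM, fun d r hS hT => ?_⟩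
    have h3 := h2 d 0 hT
    rw [inner_add_left]
    linarith [h1 d r hS]
  choose M hM0 hM using key
  let e : Fin n → EuclideanSpace ℝ (Fin n) := fun k => EuclideanSpace.single k 1
  refine ⟨∑ k, (M (e k) + M (-e k)),
    Finset.sum_nonneg fun k _ => add_nonneg (hM0 _) (hM0 _), fun d r hr hS hT => ?_⟩
  have hcoord : ∀ k, |d k| ≤ (M (e k) + M (-e k)) * r := by
    intro k
    have h1 := hM (e k) d r hS hT
    have h2 := hM (-e k) d r hS hT
    have h3 : inner ℝ (e k) d = d k := by simp [e, EuclideanSpace.inner_single_left]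
    rw [inner_neg_left, h3] at h2
    rw [h3] at h1
    have h4 := mul_nonneg (hM0 (e k)) hr
    have h5 := mul_nonneg (hM0 (-e k)) hr
    rw [add_mul]
    exact abs_le.2 ⟨by linarith, by linarith⟩
  calc ‖d‖ = ‖∑ k, d k • e k‖ := by
        congr 1
        ext i
        simp [e, Finset.sum_apply, Pi.single_apply]
    _ ≤ ∑ k, ‖d k • e k‖ := norm_sum_le _ _
    _ = ∑ k, |d k| := by simp [e, norm_smul]
    _ ≤ ∑ k, (M (e k) + M (-e k)) * r := Finset.sum_le_sum fun k _ => hcoord k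
    _ = _ := (Finset.sum_mul _ _ _).symm

end ConvexGeometry

theorem norm_toEuclideanLin_le {p n : ℕ} (C : Matrix (Fin p) (Fin n) ℝ)
    (d : EuclideanSpace ℝ (Fin n)) : ‖Matrix.toEuclideanLin C d‖ ≤ ‖C‖ * ‖d‖ := by
  -- Viewing `d` as a one-column matrix reduces the bound to submultiplicativity of the Frobenius
  -- norm.
  have h1 := Matrix.frobenius_norm_mul C (Matrix.replicateCol Unit d.ofLp)
  rwa [← Matrix.replicateCol_mulVec, Matrix.frobenius_norm_replicateCol,
    Matrix.frobenius_norm_replicateCol] at h1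

/-! ### Robust efficiency and the cone condition -/

section Optimality

variable {n p q : ℕ} {f : EuclideanSpace ℝ (Fin n) → EuclideanSpace ℝ (Fin p)}
  {g : EuclideanSpace ℝ (Fin n) → EuclideanSpace ℝ (Fin q)} {xbar : EuclideanSpace ℝ (Fin n)}

/-- Active constraints decrease to first order; inactive ones stay negative by continuity. -/
theorem eventually_add_smul_mem_feasibleSet (hg : ∀ j, LocallyLipschitz fun x => g x j)
    (hx : xbar ∈ feasibleSet g) {d : EuclideanSpace ℝ (Fin n)}
    (hd : ∀ j ∈ activeSet g xbar, clarkeDeriv (fun x => g x j) xbar d < 0) :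
    ∀ᶠ t in 𝓝[>] (0 : ℝ), xbar + t • d ∈ feasibleSet g := by
  refine eventually_all.2 fun j => ?_
  by_cases hj : g xbar j = 0
  · filter_upwards [eventually_lt_add_mul (hg j) (hd j hj)] with t ht
    rw [hj, mul_zero, add_zero] at ht
    exact ht.le
  · have hlt : g xbar j < 0 := lt_of_le_of_ne (hx j) hj
    have hcont : Tendsto (fun t : ℝ => g (xbar + t • d) j) (𝓝 0)
        (𝓝 (g (xbar + (0 : ℝ) • d) j)) :=
      Continuous.tendsto (f := fun t : ℝ => g (xbar + t • d) j)
        ((hg j).continuous.comp (by fun_prop : Continuous fun t : ℝ => xbar + t • d)) 0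
    rw [zero_smul, add_zero] at hcont
    exact nhdsWithin_le_nhds ((hcont.eventually_lt_const hlt).mono fun t ht => ht.le)

theorem pos_add_pos_eq_univ_of_isNormRobustEfficient (hp : 0 < p)
    (hf : ∀ i, LocallyLipschitz fun x => f x i) (hg : ∀ j, LocallyLipschitz fun x => g x j)
    (hrob : IsNormRobustEfficient (nonnegOrthant p) f (feasibleSet g) xbar)
    (h0 : (0 : EuclideanSpace ℝ (Fin n)) ∉
      convexHull ℝ (⋃ j ∈ activeSet g xbar, clarkeGradient (fun x => g x j) xbar)) :
    pos (⋃ i, clarkeGradient (fun x => f x i) xbar) +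
      pos (⋃ j ∈ activeSet g xbar, clarkeGradient (fun x => g x j) xbar) = univ := by
  by_contra hne
  set S := ⋃ i, clarkeGradient (fun x => f x i) xbar
  set T := ⋃ j ∈ activeSet g xbar, clarkeGradient (fun x => g x j) xbar
  obtain ⟨r, hr, hrob⟩ := hrob
  obtain ⟨d, hd0, hd⟩ := exists_ne_zero_forall_inner_nonpos
    (PointedCone.hull ℝ S ⊔ PointedCone.hull ℝ T) (by rwa [Submodule.coe_sup])
  have hfd : ∀ i, clarkeDeriv (fun x => f x i) xbar d ≤ 0 := fun i => by
    obtain ⟨ζ, hζ, heq⟩ := exists_mem_clarkeGradient_inner_eq (hf i) xbar d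
    rw [← heq]
    exact hd ζ (Submodule.mem_sup_left (PointedCone.subset_hull (mem_iUnion.2 ⟨i, hζ⟩)))
  have hgd : ∀ j ∈ activeSet g xbar, clarkeDeriv (fun x => g x j) xbar d ≤ 0 := fun j hj => by
    obtain ⟨ζ, hζ, heq⟩ := exists_mem_clarkeGradient_inner_eq (hg j) xbar d
    rw [← heq]
    exact hd ζ (Submodule.mem_sup_right (PointedCone.subset_hull (mem_biUnion hj hζ)))
  obtain ⟨d₀, hd₀⟩ := exists_forall_inner_neg (isCompact_convexHull_biUnion (toFinite _)
    (fun j _ => isCompact_clarkeGradient (hg j) xbar)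
    (fun j _ => convex_clarkeGradient _ xbar)) h0
  have hgd₀ : ∀ j ∈ activeSet g xbar, clarkeDeriv (fun x => g x j) xbar d₀ < 0 :=
    fun j hj => by
      obtain ⟨ζ, hζ, heq⟩ := exists_mem_clarkeGradient_inner_eq (hg j) xbar d₀
      rw [← heq]
      exact hd₀ ζ (mem_biUnion hj hζ)
  let C₀ : Matrix (Fin p) (Fin n) ℝ := Matrix.of fun _ k => -d k
  have hC₀ : ∀ y i, Matrix.toEuclideanLin C₀ y i = -inner ℝ d y := fun y i => by
    simp [C₀, Matrix.toLpLin_apply, Matrix.mulVec, dotProduct, PiLp.inner_apply, mul_comm]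
  obtain ⟨s, hs0, hs⟩ : ∃ s : ℝ, 0 < s ∧ ‖s • C₀‖ < r := by
    refine ⟨r / (‖C₀‖ + 1), by positivity, ?_⟩
    rw [norm_smul, Real.norm_of_nonneg (by positivity), div_mul_eq_mul_div,
      div_lt_iff₀ (by positivity)]
    exact mul_lt_mul_of_pos_left (lt_add_one _) hr
  have hdd : 0 < inner ℝ d d := real_inner_self_pos.2 hd0
  -- At `ε = 0` the inequality reads `0 < s ‖d‖²`, so it persists for small `ε > 0`.
  obtain ⟨ε, hε, hε0⟩ : ∃ ε : ℝ, (∀ i, ε * clarkeDeriv (fun x => f x i) xbar d₀ <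
      s * (inner ℝ d d + ε * inner ℝ d d₀)) ∧ 0 < ε := by
    have hev : ∀ᶠ ε in 𝓝 (0 : ℝ), ∀ i, ε * clarkeDeriv (fun x => f x i) xbar d₀ <
        s * (inner ℝ d d + ε * inner ℝ d d₀) := by
      refine eventually_all.2 fun i => ?_
      refine ContinuousAt.eventually_lt (by fun_prop) (by fun_prop) ?_
      simpa using mul_pos hs0 hdd
    exact ((hev.filter_mono nhdsWithin_le_nhds).and
      (self_mem_nhdsWithin : Ioi (0 : ℝ) ∈ 𝓝[>] 0)).exists
  have hbound : ∀ {h : EuclideanSpace ℝ (Fin n) → ℝ}, LocallyLipschitz h →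
      clarkeDeriv h xbar d ≤ 0 →
      clarkeDeriv h xbar (d + ε • d₀) ≤ ε * clarkeDeriv h xbar d₀ := fun hh hle => by
    have h1 := clarkeDeriv_add_le (x := xbar) hh d (ε • d₀)
    rw [clarkeDeriv_smul hh hε0] at h1
    linarith
  have hfeas := eventually_add_smul_mem_feasibleSet hg (hrob (s • C₀) hs).1
    (d := d + ε • d₀) fun j hj => (hbound (hg j) (hgd j hj)).trans_lt
      (mul_neg_of_pos_of_neg hε0 (hgd₀ j hj))
  have hdec : ∀ᶠ t in 𝓝[>] (0 : ℝ), ∀ i, f (xbar + t • (d + ε • d₀)) i <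
      f xbar i + t * (s * (inner ℝ d d + ε * inner ℝ d d₀)) :=
    eventually_all.2 fun i => eventually_lt_add_mul (hf i)
      ((hbound (hf i) (hfd i)).trans_lt (hε i))
  obtain ⟨t, ht1, ht2⟩ := (hfeas.and hdec).exists
  have hneg : ∀ i, (f (xbar + t • (d + ε • d₀)) +
      Matrix.toEuclideanLin (s • C₀) (xbar + t • (d + ε • d₀)) -
      (f xbar + Matrix.toEuclideanLin (s • C₀) xbar)) i < 0 := fun i => by
    have h1 := ht2 i
    have h2 : Matrix.toEuclideanLin (s • C₀) (xbar + t • (d + ε • d₀)) i -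
        Matrix.toEuclideanLin (s • C₀) xbar i =
        -(t * (s * (inner ℝ d d + ε * inner ℝ d d₀))) := by
      rw [map_smul, LinearMap.smul_apply, LinearMap.smul_apply, PiLp.smul_apply,
        PiLp.smul_apply, hC₀, hC₀, inner_add_right, real_inner_smul_right, inner_add_right,
        real_inner_smul_right, smul_eq_mul, smul_eq_mul]
      ring
    simp only [PiLp.sub_apply, PiLp.add_apply]
    linarith
  refine (hrob (s • C₀) hs).2 ⟨_, ht1, ?_, fun hzero => ?_⟩
  · rw [Set.mem_neg]
    intro i
    rw [PiLp.neg_apply]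
    exact neg_nonneg.2 (hneg i).le
  -- One strictly negative coordinate shows the difference is nonzero; this needs `0 < p`.
  · have h1 := hneg ⟨0, hp⟩
    rw [mem_singleton_iff] at hzero
    simp only at hzero
    rw [hzero] at h1
    exact lt_irrefl _ h1

theorem isNormRobustEfficient_of_pos_add_pos_eq_univ
    (hf : ∀ i, LocallyLipschitz fun x => f x i) (hg : ∀ j, LocallyLipschitz fun x => g x j)
    (hx : xbar ∈ feasibleSet g) (hfc : ∀ i, ConvexOn ℝ univ fun x => f x i)
    (hgc : ∀ j, ConvexOn ℝ univ fun x => g x j)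
    (huniv : pos (⋃ i, clarkeGradient (fun x => f x i) xbar) +
      pos (⋃ j ∈ activeSet g xbar, clarkeGradient (fun x => g x j) xbar) = univ) :
    IsNormRobustEfficient (nonnegOrthant p) f (feasibleSet g) xbar := by
  obtain ⟨M, hM, hbound⟩ := exists_norm_le_of_pos_add_pos_eq_univ huniv
  -- The `+ 1` keeps the radius meaningful when `M = 0`, and `M ‖C‖ < 1` still follows.
  refine ⟨1 / (M + 1), by positivity, fun C hC => ⟨hx, ?_⟩⟩
  rintro ⟨x, hxΩ, hle, hne⟩
  rw [Set.mem_neg] at hle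
  set d := x - xbar with hd
  have hxd : xbar + d = x := add_sub_cancel _ _
  have hCd : ∀ i, |Matrix.toEuclideanLin C d i| ≤ ‖C‖ * ‖d‖ := fun i =>
    (PiLp.norm_apply_le (Matrix.toEuclideanLin C d) i).trans (norm_toEuclideanLin_le C d)
  have hnorm := hbound d (‖C‖ * ‖d‖) (by positivity)
    (fun ζ hζ => by
      obtain ⟨i, hi⟩ := mem_iUnion.1 hζ
      have h1 := inner_le_sub_of_convexOn (hf i) (hfc i) hi d
      have h2 := hle i
      have h3 : Matrix.toEuclideanLin C d i =
          Matrix.toEuclideanLin C x i - Matrix.toEuclideanLin C xbar i := by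
        rw [hd, map_sub, PiLp.sub_apply]
      have h4 := (abs_le.1 (hCd i)).1
      simp only [PiLp.neg_apply, PiLp.sub_apply, PiLp.add_apply] at h2
      simp only [hxd] at h1
      linarith)
    (fun η hη => by
      obtain ⟨j, hj, hη⟩ := mem_iUnion₂.1 hη
      have h1 := inner_le_sub_of_convexOn (hg j) (hgc j) hη d
      have h2 : g xbar j = 0 := hj
      have h3 := hxΩ j
      simp only [hxd] at h1
      linarith)
  have hd0 : d = 0 := by
    by_contra hd0
    have hpos : 0 < ‖d‖ := norm_pos_iff.2 hd0
    have h1 : (M + 1) * ‖C‖ < 1 := by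
      rw [lt_div_iff₀ (by positivity)] at hC
      linarith
    have h2 : M * (‖C‖ * ‖d‖) ≤ (M + 1) * ‖C‖ * ‖d‖ := by
      rw [← mul_assoc]
      gcongr
      linarith
    have h3 : (M + 1) * ‖C‖ * ‖d‖ < 1 * ‖d‖ := mul_lt_mul_of_pos_right h1 hpos
    linarith
  have hxx : x = xbar := sub_eq_zero.1 hd0
  exact hne (by rw [hxx, sub_self]; rfl)

end Optimality

end NormRobust

theorem mainTheorem11 {n p q : ℕ} (hp : 2 ≤ p)
    (f : EuclideanSpace ℝ (Fin n) → EuclideanSpace ℝ (Fin p))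
    (g : EuclideanSpace ℝ (Fin n) → EuclideanSpace ℝ (Fin q))
    (hf : ∀ i, LocallyLipschitz fun x => f x i)
    (hg : ∀ j, LocallyLipschitz fun x => g x j)
    (hΩ : Convex ℝ (NormRobust.feasibleSet g))
    (xbar : EuclideanSpace ℝ (Fin n)) (hx : xbar ∈ NormRobust.feasibleSet g) :
    (NormRobust.IsNormRobustEfficient (NormRobust.nonnegOrthant p) f
          (NormRobust.feasibleSet g) xbar →
        (0 : EuclideanSpace ℝ (Fin n)) ∉
          convexHull ℝ (⋃ j ∈ NormRobust.activeSet g xbar,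
            NormRobust.clarkeGradient (fun x => g x j) xbar) →
        NormRobust.pos (⋃ i, NormRobust.clarkeGradient (fun x => f x i) xbar) +
          NormRobust.pos (⋃ j ∈ NormRobust.activeSet g xbar,
            NormRobust.clarkeGradient (fun x => g x j) xbar) = Set.univ) ∧
    ((∀ i, ConvexOn ℝ Set.univ fun x => f x i) →
        (∀ j, ConvexOn ℝ Set.univ fun x => g x j) →
        NormRobust.pos (⋃ i, NormRobust.clarkeGradient (fun x => f x i) xbar) +
          NormRobust.pos (⋃ j ∈ NormRobust.activeSet g xbar,
            NormRobust.clarkeGradient (fun x => g x j) xbar) = Set.univ →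
        NormRobust.IsNormRobustEfficient (NormRobust.nonnegOrthant p) f
          (NormRobust.feasibleSet g) xbar) := by
  exact ⟨fun hrob h0 => NormRobust.pos_add_pos_eq_univ_of_isNormRobustEfficient
      (zero_lt_two.trans_le hp) hf hg hrob h0,
    fun hfc hgc huniv => NormRobust.isNormRobustEfficient_of_pos_add_pos_eq_univ
      hf hg hx hfc hgc huniv⟩
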